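/- Let $\lambda$ be a regular cardinal. For morphisms $e\colon A\to B$, $m\colon X\to Y$ of a category write $e\perp m$ if every commutative square from $e$ to $m$ has a unique diagonal. A factorization system on a category is a pair $(\mathcal E,\mathcal M)$ of classes of morphisms such that $\mathcal M=\mathcal E^\perp$ (the morphisms $m$ with $e\perp m$ for all $e\in\mathcal E$), $\mathcal E={}^\perp\mathcal M$ (dually), and every morphism is of the form $m e$ with $e\in\mathcal E$, $m\in\mathcal M$. A $\lambda$-directed diagram of $\mathcal M$-morphisms is a diagram indexed by a $\lambda$-directed poset all of whose transition morphisms are in $\mathcal M$; an object $X$ of $\mathcal K$ is $\lambda$-generated with respect to $\mathcal M$ if $\mathcal K(X,-)\colon\mathcal K\to\mathbf{Set}$ preserves colimits of all such diagrams. A category $\mathcal K$ with a factorization system $(\mathcal E,\mathcal M)$ is $\mathcal M$-locally $\lambda$-generated if 1. $\mathcal K$ is cocomplete; 2. $\mathcal K$ is $\mathcal E$-cowellpowered, i.e. every object $K$ has, up to isomorphism under $K$, only a set of $\mathcal E$-morphisms with domain $K$; 3. for every $\lambda$-directed diagram of $\mathcal M$-morphisms, every colimit cocone consists of $\mathcal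 M$-morphisms, and for every cocone consisting of $\mathcal M$-morphisms the induced morphism from the colimit is in $\mathcal M$; 4. there is a set $\mathcal G$ of objects that are $\lambda$-generated with respect to $\mathcal M$ such that every object of $\mathcal K$ is the colimit of a $\lambda$-directed diagram of $\mathcal M$-morphisms between objects of $\mathcal G$. A $\lambda$-nest is a small category $\mathcal A$ with a factorization system $(\mathcal E_{\mathcal A},\mathcal M_{\mathcal A})$ that has $\lambda$-small limits and multiple pullbacks of $\mathcal M_{\mathcal A}$-morphisms, i.e. limits of the diagrams consisting of a small family of morphisms $f_i\colon A_i\to A$ $(i\in I)$ of $\mathcal M_{\mathcal A}$ with a common codomain. Let $\mathrm{Mod}_\lambda(\mathcal A)$ be the full subcategory of $\mathbf{Set}^{\mathcal A}$ on the functors that preserve $\lambda$-small limits and multiple pullbacks of $\mathcal M_{\mathcal A}$-morphisms; it contains the representable functors, so that there is a Yoneda embedding $Y\colon\mathcal A^{\mathrm{op}}\to\mathrm{Mod}_\lambda(\mathcal A)$, $A\mapsto\mathcal A(A,-)$. On $\mathrm{Mod}_\lambda(\mathcal A)$ let $\mathcal M=\mathcal M_{\mathcal A}^\perp$ be the class of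 morphisms $m$ with $Y(f)\perp m$ for all $f\in\mathcal M_{\mathcal A}$, and let $\mathcal E=\mathrm{colim}(\mathcal M_{\mathcal A})$ be the closure of $\{Y(f): f\in\mathcal M_{\mathcal A}\}$ under all small colimits in the category of arrows of $\mathrm{Mod}_\lambda(\mathcal A)$. **Theorem.** For every $\lambda$-nest $\mathcal A$, the pair $(\mathcal E,\mathcal M)=(\mathrm{colim}(\mathcal M_{\mathcal A}),\mathcal M_{\mathcal A}^\perp)$ is a factorization system on $\mathrm{Mod}_\lambda(\mathcal A)$, and with it $\mathrm{Mod}_\lambda(\mathcal A)$ is $\mathcal M$-locally $\lambda$-generated; in particular it is $\mathcal E$-cowellpowered. Moreover, $Y$ is full and faithful, and its essential image consists exactly of the objects of $\mathrm{Mod}_\lambda(\mathcal A)$ that are $\lambda$-generated with respect to $\mathcal M$. -/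

import Mathlib

universe w v u

open CategoryTheory Limits Opposite

namespace LocGen

section Factorization

variable {C : Type u} [Category.{v} C]

/-- `e ⊥ m`: every commutative square from `e` to `m` has exactly one diagonal. -/
def Orthogonal {A B X Y : C} (e : A ⟶ B) (m : X ⟶ Y) : Prop :=
  ∀ (f : A ⟶ X) (g : B ⟶ Y), f ≫ m = e ≫ g → ∃! d : B ⟶ X, e ≫ d = f ∧ d ≫ m = g

/-- `W^⊥`: the morphisms with the unique right lifting property against all of `W`. -/
def rightOrthogonal (W : MorphismProperty C) : MorphismProperty C :=
  fun _ _ m => ∀ ⦃A B : C⦄ (e : A ⟶ B), W e → Orthogonal e m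

/-- `^⊥W`: the morphisms with the unique left lifting property against all of `W`. -/
def leftOrthogonal (W : MorphismProperty C) : MorphismProperty C :=
  fun _ _ e => ∀ ⦃X Y : C⦄ (m : X ⟶ Y), W m → Orthogonal e m

/-- `(E, M)` is an (orthogonal) factorization system. -/
structure IsFactorizationSystem (E M : MorphismProperty C) : Prop where
  right_eq : rightOrthogonal E = M
  left_eq : leftOrthogonal M = E
  exists_factorization : ∀ ⦃X Y : C⦄ (f : X ⟶ Y),
    ∃ (Z : C) (e : X ⟶ Z) (m : Z ⟶ Y), E e ∧ M m ∧ e ≫ m = f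

/-- `colim(W)`: the closure of `W` under all small colimits in the category of arrows. -/
def colimClosure (W : MorphismProperty C) : MorphismProperty C :=
  fun _ _ f => ObjectProperty.colimitsClosure (C := Arrow C) (fun g => W g.hom)
    (fun J : Cat.{w, w} => (J : Type w)) (Arrow.mk f)

/-- `C` is `E`-cowellpowered: every object has, up to isomorphism, only a set of
`E`-quotients. -/
def IsCowellpowered (E : MorphismProperty C) : Prop :=
  ∀ X : C, ∃ (ι : Type w) (Y : ι → C) (q : ∀ i, X ⟶ Y i), (∀ i, E (q i)) ∧
    ∀ ⦃Z : C⦄ (e : X ⟶ Z), E e → ∃ (i : ι) (φ : Y i ≅ Z), q i ≫ φ.hom = e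

end Factorization

section LocallyGenerated

variable {C : Type u} [Category.{v} C] (κ : Cardinal.{w}) [Fact κ.IsRegular]

/-- `X` is `κ`-generated with respect to `M`: the functor `C(X, -)` preserves the colimits of
all diagrams of `M`-morphisms indexed by a `κ`-directed poset. -/
def IsGenerated (M : MorphismProperty C) : ObjectProperty C :=
  fun X => ∀ (J : Type w) [PartialOrder J] [IsCardinalFiltered J κ] (F : J ⥤ C),
    (∀ ⦃i j : J⦄ (a : i ⟶ j), M (F.map a)) → PreservesColimit F (coyoneda.obj (op X))

/-- `M` is closed under `κ`-directed colimits: for a `κ`-directed diagram of `M`-morphisms,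
a colimit cocone consists of `M`-morphisms, and the morphism from the colimit that is induced
by a cocone of `M`-morphisms is in `M`. -/
structure IsClosedUnderDirectedColimits (M : MorphismProperty C) : Prop where
  ι_mem : ∀ (J : Type w) [PartialOrder J] [IsCardinalFiltered J κ] (F : J ⥤ C),
    (∀ ⦃i j : J⦄ (a : i ⟶ j), M (F.map a)) →
    ∀ (c : Cocone F), IsColimit c → ∀ j, M (c.ι.app j)
  desc_mem : ∀ (J : Type w) [PartialOrder J] [IsCardinalFiltered J κ] (F : J ⥤ C),
    (∀ ⦃i j : J⦄ (a : i ⟶ j), M (F.map a)) →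
    ∀ (c : Cocone F) (hc : IsColimit c) (s : Cocone F), (∀ j, M (s.ι.app j)) → M (hc.desc s)

/-- `(E, M)` is a `κ`-convenient factorization system. -/
structure IsConvenient (E M : MorphismProperty C) : Prop where
  isFactorizationSystem : IsFactorizationSystem E M
  isCowellpowered : IsCowellpowered.{w} E
  isClosedUnderDirectedColimits : IsClosedUnderDirectedColimits κ M

/-- `C`, with the factorization system `(E, M)`, is `M`-locally `κ`-generated. -/
structure IsLocallyGenerated (E M : MorphismProperty C) : Prop where
  hasColimits : HasColimitsOfSize.{w, w} C
  isConvenient : IsConvenient κ E M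
  exists_generators : ∃ P : ObjectProperty C, ObjectProperty.Small.{w} P ∧
    P ≤ IsGenerated κ M ∧
    ∀ X : C, ∃ (J : Type w) (_ : PartialOrder J) (_ : IsCardinalFiltered J κ)
      (pres : ColimitPresentation J X), (∀ j, P (pres.diag.obj j)) ∧
        ∀ ⦃i j : J⦄ (a : i ⟶ j), M (pres.diag.map a)

end LocallyGenerated

/-- The structure of a `κ`-nest on a small category `A`: a factorization system `(E, M)`, such
that `A` has `κ`-small limits and multiple pullbacks of arbitrary small families of
`M`-morphisms. -/
structure Nest (κ : Cardinal.{w}) (A : Type w) [SmallCategory.{w} A] where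
  E : MorphismProperty A
  M : MorphismProperty A
  isFactorizationSystem : IsFactorizationSystem E M
  hasLimitsOfShape : ∀ (J : Type w) [SmallCategory.{w} J], HasCardinalLT (Arrow J) κ →
    HasLimitsOfShape J A
  hasWidePullback : ∀ (I : Type w) (B : A) (X : I → A) (f : ∀ i, X i ⟶ B),
    (∀ i, M (f i)) → HasWidePullback B X f

namespace Nest

variable {κ : Cardinal.{w}} {A : Type w} [SmallCategory.{w} A] (N : Nest κ A)

/-- A model of the nest: a functor `A ⥤ Set` that preserves `κ`-small limits and multiple
pullbacks of `M`-morphisms. -/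
structure IsModel (F : A ⥤ Type w) : Prop where
  preservesLimitsOfShape : ∀ (J : Type w) [SmallCategory.{w} J], HasCardinalLT (Arrow J) κ →
    PreservesLimitsOfShape J F
  preservesWidePullback : ∀ (I : Type w) (B : A) (X : I → A) (f : ∀ i, X i ⟶ B),
    (∀ i, N.M (f i)) → PreservesLimit (WidePullbackShape.wideCospan B X f) F

/-- Models, as a property of functors. -/
def isModel : ObjectProperty (A ⥤ Type w) := fun F => N.IsModel F

/-- The category `Mod_κ(A)` of models, full in the category of functors `A ⥤ Set`. -/
abbrev Mod : Type (w + 1) := N.isModel.FullSubcategory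

theorem isModel_coyoneda (X : Aᵒᵖ) : N.isModel (coyoneda.obj X) where
  preservesLimitsOfShape _ _ _ := inferInstance
  preservesWidePullback _ _ _ _ _ := inferInstance

/-- The Yoneda embedding `Aᵒᵖ ⥤ Mod_κ(A)`, `X ↦ A(X, -)`. -/
def y : Aᵒᵖ ⥤ N.Mod := N.isModel.lift coyoneda N.isModel_coyoneda

/-- The class `M` of the nest, seen as a class of morphisms between representable models. -/
def yM : MorphismProperty N.Mod := N.M.op.strictMap N.y

/-- The left class `colim(M_A)` on `Mod_κ(A)`. -/
def modE : MorphismProperty N.Mod := colimClosure.{w} N.yM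

/-- The right class `M_A^⊥` on `Mod_κ(A)`. -/
def modM : MorphismProperty N.Mod := rightOrthogonal N.yM

end Nest

end LocGen

/-! Fibre powers of every size exist along an `M`-morphism of the small category `A`, so a Cantor
argument makes it a monomorphism (`mono_of_mem`). Hence models send `M`-morphisms to injections, and
a morphism `f : F ⟶ G` of models lies in `modM` exactly when it reflects membership in the images of
`M`-morphisms (`modM_iff`).

Intersecting all `M`-subobjects that support an element `y` of a model gives a least one, its core
(`exists_isMinimal`). Minimality says that the morphism from the representable at the core is in
`modM`. To factor `f : X ⟶ Y`, write `X` as the canonical colimit of representables over its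
elements and replace the representable at each element by the one at the core of its image in `Y`.
The comparison is a colimit of morphisms in `yM`, and the remaining morphism to `Y` is in `modM`,
because `κ`-filtered colimits along `modM` are computed pointwise (`isModel_of_isColimit`).

Factoring `𝟙 X` presents `X` by representables along `modM`. A generated object is therefore a
retract of a representable, and idempotents split in `A`. Quotients in `modE` are determined by the
`M`-subobjects into which they send elements, and cocompleteness holds because models are the local
objects for a small set of morphisms. -/

namespace LocGen

/-! ### Stability of the right class of a factorization system, for monomorphisms. -/

section Factorization

variable {C : Type u} [Category.{v} C] {E M : MorphismProperty C}

/-- Orthogonality against a monomorphism only requires the existence of a diagonal. -/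
theorem orthogonal_of_mono {A B X Y : C} {e : A ⟶ B} {m : X ⟶ Y} [Mono m]
    (h : ∀ (f : A ⟶ X) (g : B ⟶ Y), f ≫ m = e ≫ g → ∃ d : B ⟶ X, d ≫ m = g) :
    Orthogonal e m := fun f g w ↦ by
  obtain ⟨d, hd⟩ := h f g w
  refine ⟨d, ⟨?_, hd⟩, fun d' hd' ↦ ?_⟩
  · rw [← cancel_mono m, Category.assoc, hd, w]
  · rw [← cancel_mono m, hd, hd'.2]

namespace IsFactorizationSystem

theorem orthogonal (h : IsFactorizationSystem E M) {A B X Y : C} {e : A ⟶ B} {m : X ⟶ Y}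
    (he : E e) (hm : M m) : Orthogonal e m := by
  rw [← h.right_eq] at hm
  exact hm e he

theorem comp_mem (h : IsFactorizationSystem E M) {X Y Z : C} {f : X ⟶ Y} {g : Y ⟶ Z}
    (hf : M f) (hg : M g) [Mono f] [Mono g] : M (f ≫ g) := by
  rw [← h.right_eq]
  intro A B e he
  refine orthogonal_of_mono fun a b w ↦ ?_
  obtain ⟨d, ⟨hd, hd'⟩, -⟩ := h.orthogonal he hg (a ≫ f) b (by simpa using w)
  obtain ⟨d₁, ⟨_, hd₁⟩, -⟩ := h.orthogonal he hf a d hd.symm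
  exact ⟨d₁, by rw [← Category.assoc, hd₁, hd']⟩

theorem pullback_snd_mem (h : IsFactorizationSystem E M) {X Y Z : C} {f : X ⟶ Y} (g : Z ⟶ Y)
    (hf : M f) [Mono f] [HasPullback f g] : M (pullback.snd f g) := by
  rw [← h.right_eq]
  intro A B e he
  refine orthogonal_of_mono fun a b w ↦ ?_
  obtain ⟨d, ⟨hd, hd'⟩, -⟩ := h.orthogonal he hf (a ≫ pullback.fst f g) (b ≫ g) (by
    rw [Category.assoc, pullback.condition, reassoc_of% w])
  exact ⟨pullback.lift d b hd', pullback.lift_snd _ _ _⟩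

theorem widePullback_base_mem (h : IsFactorizationSystem E M) {I : Type w} {B : C} {X : I → C}
    (f : ∀ i, X i ⟶ B) (hf : ∀ i, M (f i)) [HasWidePullback B X f] [Mono (WidePullback.base f)] :
    M (WidePullback.base f) := by
  rw [← h.right_eq]
  intro A B e he
  refine orthogonal_of_mono fun a b w ↦ ?_
  choose d hd _ using fun i ↦ h.orthogonal he (hf i) (a ≫ WidePullback.π f i) b (by simpa using w)
  exact ⟨WidePullback.lift b d (fun i ↦ (hd i).2), WidePullback.lift_base _ _ _ _⟩

end IsFactorizationSystem

end Factorization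

theorem mono_widePullback_base {C : Type u} [Category.{v} C] {I : Type w} {B : C} {X : I → C}
    (f : ∀ i, X i ⟶ B) [∀ i, Mono (f i)] [HasWidePullback B X f] :
    Mono (WidePullback.base f) where
  right_cancellation g h w := WidePullback.hom_ext _ _ _
    (fun j ↦ by simpa [← cancel_mono (f j)] using w) w

theorem hasCardinalLT_arrow_of_finCategory (κ : Cardinal.{w}) [hκ : Fact κ.IsRegular]
    (J : Type w) [SmallCategory J] [FinCategory J] : HasCardinalLT (Arrow J) κ := by
  refine HasCardinalLT.of_le ?_ hκ.out.aleph0_le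
  simp only [hasCardinalLT_aleph0_iff]
  infer_instance

/-! ### The `M`-morphisms of a nest are monomorphisms. -/

namespace Nest

variable {κ : Cardinal.{w}} {A : Type w} [SmallCategory.{w} A] (N : Nest κ A)

/-- In a small category, the existence of arbitrary fibre powers of `m` forces `m` to be mono. -/
theorem mono_of_mem {b a : A} (m : b ⟶ a) (hm : N.M m) : Mono m where
  right_cancellation {X} u v huv := by
    classical
    by_contra hne
    have := N.hasWidePullback (Arrow A) a (fun _ ↦ b) (fun _ ↦ m) (fun _ ↦ hm)
    -- If `u ≠ v`, choosing `u` or `v` in each coordinate embeds the power set of `Arrow A` into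
    -- `Arrow A`.
    let φ (s : Set (Arrow A)) : Arrow A := Arrow.mk
      (WidePullback.lift (arrows := fun _ : Arrow A ↦ m) (u ≫ m)
        (fun i ↦ if i ∈ s then u else v) (fun i ↦ by split_ifs <;> simp [huv]))
    refine Function.cantor_injective φ fun s t hst ↦ ?_
    have hst' := (Arrow.mk_inj _ _).1 hst
    ext i
    have := hst' =≫ WidePullback.π _ i
    simp only [WidePullback.lift_π] at this
    by_cases hs : i ∈ s <;> by_cases ht : i ∈ t <;> simp_all

section

variable [Fact κ.IsRegular]

theorem hasFiniteLimits (N : Nest κ A) : HasFiniteLimits A :=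
  hasFiniteLimits_of_hasFiniteLimits_of_size A fun J _ _ ↦
    N.hasLimitsOfShape J (hasCardinalLT_arrow_of_finCategory κ J)

variable {N}

theorem IsModel.preservesFiniteLimits {F : A ⥤ Type w} (hF : N.IsModel F) :
    PreservesFiniteLimits F :=
  preservesFiniteLimits_of_preservesFiniteLimitsOfSize.{w} F fun J _ _ ↦
    hF.preservesLimitsOfShape J (hasCardinalLT_arrow_of_finCategory κ J)

theorem IsModel.map_injective {F : A ⥤ Type w} (hF : N.IsModel F) {b a : A} {m : b ⟶ a}
    (hm : N.M m) : Function.Injective (F.map m) := by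
  have := hF.preservesFiniteLimits
  have := N.mono_of_mem m hm
  rw [← mono_iff_injective]
  infer_instance

end

end Nest

/-! ### Set-valued functors and intersections of subobjects. -/

section WidePullback

variable {C : Type u} [Category.{v} C] {I : Type w} {B : C} {X : I → C} (f : ∀ i, X i ⟶ B)
  [HasWidePullback B X f] (F : C ⥤ Type w)

theorem mem_range_map_base [PreservesLimit (WidePullbackShape.wideCospan B X f) F] (x : F.obj B)
    (hx : ∀ i, x ∈ Set.range (F.map (f i))) : x ∈ Set.range (F.map (WidePullback.base f)) := by
  choose t ht using hx
  obtain ⟨z, hz, -⟩ := (Types.isLimit_iff _).1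
    ⟨isLimitOfPreserves F (limit.isLimit (WidePullbackShape.wideCospan B X f))⟩
    (fun | none => x | some i => t i) (by
      rintro _ _ (_ | i)
      · exact ConcreteCategory.congr_hom (F.map_id _) _
      · exact ht i)
  exact ⟨z, hz none⟩

/-- Once the maps are injective, a compatible family is determined by its component at `B`, so only
existence is at stake. -/
theorem preservesLimit_wideCospan (hf : ∀ i, Function.Injective (F.map (f i)))
    (hb : Function.Injective (F.map (WidePullback.base f)))
    (h : ∀ x : F.obj B, (∀ i, x ∈ Set.range (F.map (f i))) →
      x ∈ Set.range (F.map (WidePullback.base f))) :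
    PreservesLimit (WidePullbackShape.wideCospan B X f) F := by
  refine preservesLimit_of_preserves_limit_cone (limit.isLimit _)
    ((Types.isLimit_iff _).2 fun s hs ↦ ?_).some
  have hs' (i : I) : F.map (f i) (s (some i)) = s none := hs (WidePullbackShape.Hom.term i)
  obtain ⟨z, hz⟩ := h (s none) fun i ↦ ⟨s (some i), hs' i⟩
  refine ⟨z, ?_, fun z' hz' ↦ hb ((hz' none).trans hz.symm)⟩
  rintro (_ | i)
  · exact hz
  · refine hf i ?_
    rw [hs' i, ← hz, ← WidePullback.π_arrow f i, F.map_comp]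
    rfl

end WidePullback

section Types

variable {C : Type u} [Category.{v} C] (F : C ⥤ Type w)

theorem mem_range_map_pullback_snd {b a c : C} (m : b ⟶ a) (u : c ⟶ a) [HasPullback m u]
    [PreservesLimit (cospan m u) F] (z : F.obj c) (hz : F.map u z ∈ Set.range (F.map m)) :
    z ∈ Set.range (F.map (pullback.snd m u)) := by
  obtain ⟨t, ht⟩ := hz
  obtain ⟨p, hp, -⟩ := (Types.isLimit_iff _).1
    ⟨isLimitOfPreserves F (limit.isLimit (cospan m u))⟩
    (fun | none => F.map u z | some .left => t | some .right => z) (by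
      rintro _ _ (_ | (_ | _))
      · exact ConcreteCategory.congr_hom (F.map_id _) _
      · exact ht
      · rfl)
  exact ⟨p, hp (some .right)⟩

end Types

/-! ### Cores of elements, and a description of `modM` by elements. -/

namespace Nest

variable {κ : Cardinal.{w}} {A : Type w} [SmallCategory.{w} A] (N : Nest κ A)

/-- An element `z` of a model at `b` is minimal if it does not come from a proper
`M`-subobject of `b`, in the strong sense that the corresponding morphism from the representable
model at `b` is in `M_A^⊥`. -/
def IsMinimal (Y : A ⥤ Type w) {b : A} (z : Y.obj b) : Prop :=
  ∀ ⦃d c : A⦄ (m : d ⟶ c), N.M m → ∀ u : b ⟶ c, Y.map u z ∈ Set.range (Y.map m) →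
    ∃ v : b ⟶ d, v ≫ m = u

variable [Fact κ.IsRegular] {N}

/-- Intersect all `M`-subobjects of `a` that support `y`: they form a small family, `Y` preserves
the intersection, and so `y` lifts to it. -/
theorem IsModel.exists_isMinimal {Y : A ⥤ Type w} (hY : N.IsModel Y) {a : A} (y : Y.obj a) :
    ∃ (b : A) (m : b ⟶ a) (z : Y.obj b), N.M m ∧ Y.map m z = y ∧ N.IsMinimal Y z := by
  have := N.hasFiniteLimits
  have := hY.preservesFiniteLimits
  let I := { f : Over a // N.M f.hom ∧ y ∈ Set.range (Y.map f.hom) }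
  let f (i : I) : i.1.left ⟶ a := i.1.hom
  have hf (i : I) : N.M (f i) := i.2.1
  have (i : I) : Mono (f i) := N.mono_of_mem _ (hf i)
  have := N.hasWidePullback I a _ f hf
  have := hY.preservesWidePullback I a _ f hf
  have := mono_widePullback_base f
  have hb := N.isFactorizationSystem.widePullback_base_mem f hf
  obtain ⟨z, hz⟩ := mem_range_map_base f Y y fun i ↦ i.2.2
  refine ⟨_, WidePullback.base f, z, hb, hz, fun d c m hm u hu ↦ ?_⟩
  have := N.mono_of_mem m hm
  obtain ⟨t, ht⟩ := mem_range_map_pullback_snd Y m u z hu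
  -- The pullback of `m` along `u` also supports `y`, so it is a member of the family and contains
  -- the intersection: its projection `pullback.snd m u` has a section.
  let i : I := ⟨Over.mk (pullback.snd m u ≫ WidePullback.base f),
    N.isFactorizationSystem.comp_mem (N.isFactorizationSystem.pullback_snd_mem u hm) hb,
    t, by
      refine Eq.trans (ConcreteCategory.congr_hom (Y.map_comp _ _) t) ?_
      rw [comp_apply, ht, hz]⟩
  have hi : WidePullback.π f i ≫ pullback.snd m u = 𝟙 _ := by
    rw [← cancel_mono (WidePullback.base f), Category.assoc, Category.id_comp]
    exact WidePullback.π_arrow f i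
  exact ⟨WidePullback.π f i ≫ pullback.fst m u, by
    rw [Category.assoc, pullback.condition, reassoc_of% hi]⟩

section Core

variable {Y : A ⥤ Type w} (hY : N.IsModel Y)

/-- The least `M`-subobject of `p.1` that contains the element `p.2`. -/
noncomputable def core (p : Y.Elements) : A := (hY.exists_isMinimal p.2).choose

/-- The inclusion of the least `M`-subobject that contains a given element. -/
noncomputable def coreι (p : Y.Elements) : core hY p ⟶ p.1 :=
  (hY.exists_isMinimal p.2).choose_spec.choose

/-- The restriction of an element to the least `M`-subobject that contains it. -/
noncomputable def coreElt (p : Y.Elements) : Y.obj (core hY p) :=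
  (hY.exists_isMinimal p.2).choose_spec.choose_spec.choose

theorem coreι_mem (p : Y.Elements) : N.M (coreι hY p) :=
  (hY.exists_isMinimal p.2).choose_spec.choose_spec.choose_spec.1

theorem map_coreι_coreElt (p : Y.Elements) : Y.map (coreι hY p) (coreElt hY p) = p.2 :=
  (hY.exists_isMinimal p.2).choose_spec.choose_spec.choose_spec.2.1

theorem isMinimal_coreElt (p : Y.Elements) : N.IsMinimal Y (coreElt hY p) :=
  (hY.exists_isMinimal p.2).choose_spec.choose_spec.choose_spec.2.2

theorem exists_coreMap {p q : Y.Elements} (g : p ⟶ q) :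
    ∃ v : core hY p ⟶ core hY q, v ≫ coreι hY q = coreι hY p ≫ g.1 :=
  isMinimal_coreElt hY p _ (coreι_mem hY q) _ ⟨coreElt hY q, by
    rw [map_coreι_coreElt, Functor.map_comp, comp_apply, map_coreι_coreElt, g.2]⟩

/-- The functoriality of `core`. -/
noncomputable def coreMap {p q : Y.Elements} (g : p ⟶ q) : core hY p ⟶ core hY q :=
  (exists_coreMap hY g).choose

theorem coreMap_coreι {p q : Y.Elements} (g : p ⟶ q) :
    coreMap hY g ≫ coreι hY q = coreι hY p ≫ g.1 :=
  (exists_coreMap hY g).choose_spec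

theorem map_coreMap_coreElt {p q : Y.Elements} (g : p ⟶ q) :
    Y.map (coreMap hY g) (coreElt hY p) = coreElt hY q := by
  refine hY.map_injective (coreι_mem hY q) ?_
  rw [← comp_apply, ← Functor.map_comp, coreMap_coreι, map_coreι_coreElt, Functor.map_comp,
    comp_apply, map_coreι_coreElt, g.2]

/-- The functor that sends an element of a model to its core. -/
noncomputable def coreFunctor : Y.Elements ⥤ A where
  obj := core hY
  map := coreMap hY
  map_id p := by
    have := N.mono_of_mem _ (coreι_mem hY p)
    rw [← cancel_mono (coreι hY p), coreMap_coreι]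
    simp
  map_comp {p q r} g h := by
    have := N.mono_of_mem _ (coreι_mem hY r)
    rw [← cancel_mono (coreι hY r), coreMap_coreι, Category.assoc, coreMap_coreι,
      ← Category.assoc, coreMap_coreι, Category.assoc]
    rfl

/-- The inclusions of the cores, as a natural transformation. -/
noncomputable def coreFunctorι : coreFunctor hY ⟶ CategoryOfElements.π Y where
  app := coreι hY
  naturality _ _ g := coreMap_coreι hY g

end Core

-- By Yoneda, a square from `N.y.map m.op` to `f` is a pair of elements `x`, `z` with `f x = G(m)
-- z`, and a diagonal is a preimage of `x` under `F(m)`. Injectivity of `F(m)` and `G(m)` supplies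
-- uniqueness and the second triangle.
variable (N) in
theorem modM_iff {F G : N.Mod} (f : F ⟶ G) :
    N.modM f ↔ ∀ ⦃b a : A⦄ (m : b ⟶ a), N.M m → ∀ x : F.obj.obj a,
      f.hom.app a x ∈ Set.range (G.obj.map m) → x ∈ Set.range (F.obj.map m) := by
  constructor
  · intro hf b a m hm x ⟨z, hz⟩
    obtain ⟨d, ⟨hd, -⟩, -⟩ := hf (N.y.map m.op)
      (MorphismProperty.map_mem_strictMap _ N.y m.op hm)
      (ObjectProperty.homMk (coyonedaEquiv.symm x)) (ObjectProperty.homMk (coyonedaEquiv.symm z))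
      (by
        ext : 1
        apply coyonedaEquiv.injective
        change f.hom.app a (F.obj.map (𝟙 a) x) = G.obj.map (m ≫ 𝟙 a) z
        simp [hz])
    refine ⟨coyonedaEquiv d.hom, ?_⟩
    have := congr_arg (fun g ↦ coyonedaEquiv g.hom) hd
    refine (coyonedaEquiv_naturality d.hom m).trans (this.trans ?_)
    exact coyonedaEquiv.apply_symm_apply x
  · rintro hf _ _ _ @⟨a, b, m, hm⟩ p q hpq
    have hx : f.hom.app a.unop (coyonedaEquiv p.hom) =
        G.obj.map m.unop (coyonedaEquiv q.hom) := by
      refine Eq.trans ?_ (coyonedaEquiv_naturality q.hom m.unop).symm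
      exact congr_arg (fun g ↦ coyonedaEquiv g.hom) hpq
    obtain ⟨t, ht⟩ := hf m.unop hm (coyonedaEquiv p.hom) ⟨_, hx.symm⟩
    have hinj := F.property.map_injective hm
    have key (g : N.y.obj b ⟶ F) : N.y.map m ≫ g = p ↔ coyonedaEquiv g.hom = t := by
      rw [← hinj.eq_iff, ht]
      refine Iff.trans ?_ (Eq.congr_left (coyonedaEquiv_naturality g.hom m.unop)).symm
      refine Iff.trans ?_ coyonedaEquiv.injective.eq_iff.symm
      exact ⟨fun h ↦ congr_arg (fun g ↦ g.hom) h, fun h ↦ ObjectProperty.hom_ext _ h⟩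
    refine ⟨ObjectProperty.homMk (coyonedaEquiv.symm t), ⟨?_, ?_⟩, fun g hg ↦ ?_⟩
    · exact (key _).2 (coyonedaEquiv.apply_symm_apply t)
    · ext : 1
      apply coyonedaEquiv.injective
      apply G.property.map_injective hm
      rw [← hx, ← ht]
      change G.obj.map m.unop (f.hom.app b.unop (F.obj.map (𝟙 _) t)) = _
      simp [NatTrans.naturality_apply]
    · ext : 1
      apply coyonedaEquiv.injective
      rw [(key g).1 hg.1]
      exact (coyonedaEquiv.apply_symm_apply t).symm

end Nest

/-! ### `κ`-filtered colimits of models along `modM`. -/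

section FilteredColimits

variable {κ : Cardinal.{w}} [Fact κ.IsRegular] {J : Type w} [SmallCategory J]
  [IsCardinalFiltered J κ] {C : Type u} [Category.{v} C] {G : J ⥤ C ⥤ Type w} {c : Cocone G}

/-- A pointwise `κ`-filtered colimit of functors that preserve a `κ`-small limit preserves it. -/
theorem nonempty_isLimit_mapCone_of_isColimit
    (hc : ∀ a, IsColimit (((evaluation C (Type w)).obj a).mapCocone c))
    {K : Type w} [SmallCategory K] (hK : HasCardinalLT (Arrow K) κ) {D : K ⥤ C} (s : Cone D)
    (h : ∀ j, Nonempty (IsLimit ((G.obj j).mapCone s))) :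
    Nonempty (IsLimit (c.pt.mapCone s)) := by
  have := isFiltered_of_isCardinalFiltered J κ
  simp only [Types.isLimit_iff] at h ⊢
  intro x hx
  refine existsUnique_of_exists_of_unique ?_ fun y₁ y₂ h₁ h₂ ↦ ?_
  -- Existence: `κ`-small limits of sets commute with `κ`-filtered colimits, so the whole compatible
  -- family comes from one stage.
  · let L := evaluation K (Type w)
    have hL (Y : K ⥤ Type w) : IsLimit (((evaluation _ _).obj Y).mapCone (limit.cone L)) :=
      isLimitOfPreserves _ (limit.isLimit L)
    obtain ⟨j, z, hz⟩ := Functor.Accessible.Limits.isColimitMapCocone.surjective (limit.cone L)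
      hL κ hK (((Functor.whiskeringLeft K C (Type w)).obj D).mapCocone c) (fun k ↦ hc (D.obj k))
      ((Types.isLimitEquivSections (hL (D ⋙ c.pt))).symm ⟨x, hx⟩)
    obtain ⟨y, hy, -⟩ := h j _ (Types.isLimitEquivSections (hL (D ⋙ G.obj j)) z).2
    refine ⟨(c.ι.app j).app s.pt y, fun k ↦ ?_⟩
    have h₁ := Types.isLimitEquivSections_symm_apply (hL (D ⋙ c.pt)) ⟨x, hx⟩ k
    refine Eq.trans ?_ h₁
    rw [hz]
    refine (NatTrans.naturality_apply (c.ι.app j) (s.π.app k) y).symm.trans ?_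
    refine (congr_arg ((c.ι.app j).app (D.obj k)) (hy k)).trans ?_
    rw [Types.isLimitEquivSections_apply]
    exact NatTrans.naturality_apply ((limit.cone L).π.app k) (D.whiskerLeft (c.ι.app j)) z |>.symm
  · obtain ⟨j, z₁, z₂, hz₁, hz₂⟩ := Types.FilteredColimit.jointly_surjective_of_isColimit₂
      (hc s.pt) y₁ y₂
    have H (k : K) := (Types.FilteredColimit.isColimit_eq_iff' (hc (D.obj k))
      ((G.obj j).map (s.π.app k) z₁) ((G.obj j).map (s.π.app k) z₂)).1 (by
        refine (NatTrans.naturality_apply (c.ι.app j) (s.π.app k) z₁).trans ?_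
        refine Eq.trans ?_ (NatTrans.naturality_apply (c.ι.app j) (s.π.app k) z₂).symm
        refine (congr_arg (c.pt.map (s.π.app k)) hz₁).trans ?_
        refine Eq.trans ?_ (congr_arg (c.pt.map (s.π.app k)) hz₂).symm
        exact (h₁ k).trans (h₂ k).symm)
    choose j' a ha using H
    -- For each `k` the two projections agree at some stage; there are fewer than `κ` indices `k`,
    -- so a common stage exists.
    obtain ⟨l, b, b', hb⟩ := IsCardinalFiltered.wideSpan a
      (hasCardinalLT_of_hasCardinalLT_arrow hK)
    have key : (G.map b').app s.pt z₁ = (G.map b').app s.pt z₂ := by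
      refine (h l (fun k ↦ (G.obj l).map (s.π.app k) ((G.map b').app s.pt z₁)) ?_).unique
        (fun _ ↦ rfl) (fun k ↦ ?_)
      · intro k k' φ
        rw [Functor.comp_map, ← comp_apply, ← Functor.map_comp, s.w]
      · refine (NatTrans.naturality_apply (G.map b') (s.π.app k) z₂).symm.trans ?_
        refine Eq.trans ?_ (NatTrans.naturality_apply (G.map b') (s.π.app k) z₁)
        rw [← hb k, G.map_comp]
        exact congr_arg ((G.map (b k)).app (D.obj k)) (ha k).symm
    rw [← hz₁, ← hz₂]
    have hw := congr_arg (fun φ ↦ φ.app s.pt) (c.w b')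
    refine (ConcreteCategory.congr_hom hw z₁).symm.trans ?_
    refine Eq.trans ?_ (ConcreteCategory.congr_hom hw z₂)
    exact congr_arg ((c.ι.app l).app s.pt) key

end FilteredColimits

namespace Nest

variable {κ : Cardinal.{w}} {A : Type w} [SmallCategory.{w} A] {N : Nest κ A} [Fact κ.IsRegular]
  {J : Type w} [SmallCategory J] [IsCardinalFiltered J κ] {F : J ⥤ N.Mod}

/-- A pointwise `κ`-filtered colimit of models along morphisms in `M_A^⊥` is a model. -/
theorem isModel_of_isColimit (hF : ∀ ⦃i j : J⦄ (a : i ⟶ j), N.modM (F.map a))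
    {c : Cocone (F ⋙ N.isModel.ι)} (hc : IsColimit c) : N.IsModel c.pt := by
  have := isFiltered_of_isCardinalFiltered J κ
  have := N.hasFiniteLimits
  have hc' (a : A) : IsColimit (((evaluation A (Type w)).obj a).mapCocone c) :=
    isColimitOfPreserves _ hc
  have h₁ (K : Type w) [SmallCategory K] (hK : HasCardinalLT (Arrow K) κ) :
      PreservesLimitsOfShape K c.pt :=
    ⟨fun {D} ↦ ⟨fun {s} hs ↦ nonempty_isLimit_mapCone_of_isColimit hc' hK s fun j ↦ by
      have := (F.obj j).property.preservesLimitsOfShape K hK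
      exact ⟨isLimitOfPreserves (F.obj j).obj hs⟩⟩⟩
  have := preservesFiniteLimits_of_preservesFiniteLimitsOfSize.{w} c.pt fun K _ _ ↦
    h₁ K (hasCardinalLT_arrow_of_finCategory κ K)
  refine ⟨h₁, fun I B X f hf ↦ ?_⟩
  have := N.hasWidePullback I B X f hf
  have (i : I) : Mono (f i) := N.mono_of_mem _ (hf i)
  have := mono_widePullback_base f
  refine preservesLimit_wideCospan f c.pt (fun i ↦ (mono_iff_injective _).1 inferInstance)
    ((mono_iff_injective _).1 inferInstance) fun x hx ↦ ?_
  obtain ⟨j, y, rfl⟩ := Types.jointly_surjective_of_isColimit (hc' B) x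
  have := (F.obj j).property.preservesWidePullback I B X f hf
  -- The family `I` may be too large for a common later stage. None is needed: transition morphisms
  -- in `modM` reflect membership in the image of `f i` back to the stage `j` of `y`.
  obtain ⟨z, hz⟩ := mem_range_map_base f (F.obj j).obj y fun i ↦ by
    obtain ⟨t, ht⟩ := hx i
    obtain ⟨k, t, rfl⟩ := Types.jointly_surjective_of_isColimit (hc' (X i)) t
    have ht' := (NatTrans.naturality_apply (c.ι.app k) (f i) t).trans ht
    obtain ⟨l, a, b, hab⟩ := (Types.FilteredColimit.isColimit_eq_iff _ (hc' B)).1 ht'.symm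
    refine (N.modM_iff _).1 (hF a) (f i) (hf i) y ⟨(F.map b).hom.app _ t, ?_⟩
    exact (NatTrans.naturality_apply (F.map b).hom (f i) t).symm.trans hab.symm
  exact ⟨(c.ι.app j).app _ z, by
    rw [← hz]
    exact (NatTrans.naturality_apply (c.ι.app j) _ z).symm⟩

/-- The cocone of models on a cocone of functors whose point is a model. -/
def coconeOfIsModel (c : Cocone (F ⋙ N.isModel.ι)) (h : N.IsModel c.pt) : Cocone F where
  pt := ⟨c.pt, h⟩
  ι :=
    { app j := ObjectProperty.homMk (c.ι.app j)
      naturality i j a := by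
        ext : 1
        exact c.ι.naturality a }

/-- A cocone of models is a colimit as soon as it is one in the category of functors. -/
noncomputable def isColimitCoconeOfIsModel {c : Cocone (F ⋙ N.isModel.ι)} (h : N.IsModel c.pt)
    (hc : IsColimit c) : IsColimit (coconeOfIsModel c h) :=
  isColimitOfReflects N.isModel.ι hc

theorem preservesColimit_ι (hF : ∀ ⦃i j : J⦄ (a : i ⟶ j), N.modM (F.map a)) :
    PreservesColimit F N.isModel.ι :=
  preservesColimit_of_preserves_colimit_cocone
    (isColimitCoconeOfIsModel (isModel_of_isColimit hF (colimit.isColimit _))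
      (colimit.isColimit _)) (colimit.isColimit (F ⋙ N.isModel.ι))

/-- Morphisms from a representable model are elements. -/
def coyonedaYIso (a : Aᵒᵖ) :
    coyoneda.obj (op (N.y.obj a)) ≅ N.isModel.ι ⋙ (evaluation A (Type w)).obj a.unop :=
  NatIso.ofComponents (fun _ ↦ (N.isModel.fullyFaithfulι.homEquiv.trans coyonedaEquiv).toIso)
    (fun _ ↦ rfl)

variable (N) in
theorem isGenerated_y (a : Aᵒᵖ) : IsGenerated κ N.modM (N.y.obj a) := fun J _ _ F hF ↦ by
  have := preservesColimit_ι hF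
  exact preservesColimit_of_natIso F (coyonedaYIso a).symm

/-- A colimit of models along morphisms in `M_A^⊥` is pointwise. -/
theorem exists_isColimit_eval (hF : ∀ ⦃i j : J⦄ (a : i ⟶ j), N.modM (F.map a))
    {c : Cocone F} (hc : IsColimit c) (a : A) : Nonempty (IsColimit
    ((N.isModel.ι ⋙ (evaluation A (Type w)).obj a).mapCocone c)) := by
  have := preservesColimit_ι hF
  exact ⟨isColimitOfPreserves _ hc⟩

theorem modM_ι_app (hF : ∀ ⦃i j : J⦄ (a : i ⟶ j), N.modM (F.map a))
    {c : Cocone F} (hc : IsColimit c) (j : J) : N.modM (c.ι.app j) := by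
  have := isFiltered_of_isCardinalFiltered J κ
  rw [modM_iff]
  intro b a m hm x ⟨z, hz⟩
  obtain ⟨hb⟩ := exists_isColimit_eval hF hc b
  obtain ⟨ha⟩ := exists_isColimit_eval hF hc a
  obtain ⟨k, t, rfl⟩ := Types.jointly_surjective_of_isColimit hb z
  have ht := (NatTrans.naturality_apply (c.ι.app k).hom m t).trans hz
  obtain ⟨l, f, g, hfg⟩ := (Types.FilteredColimit.isColimit_eq_iff _ ha).1 ht.symm
  exact (N.modM_iff _).1 (hF f) m hm x ⟨(F.map g).hom.app _ t,
    (NatTrans.naturality_apply (F.map g).hom m t).symm.trans hfg.symm⟩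

theorem modM_of_comp_ι (hF : ∀ ⦃i j : J⦄ (a : i ⟶ j), N.modM (F.map a))
    {c : Cocone F} (hc : IsColimit c) {Y : N.Mod} (f : c.pt ⟶ Y)
    (hf : ∀ j, N.modM (c.ι.app j ≫ f)) :
    N.modM f := by
  rw [modM_iff]
  intro b a m hm x hx
  obtain ⟨ha⟩ := exists_isColimit_eval hF hc a
  obtain ⟨j, x, rfl⟩ := Types.jointly_surjective_of_isColimit ha x
  obtain ⟨z, hz⟩ := (N.modM_iff _).1 (hf j) m hm x hx
  exact ⟨(c.ι.app j).hom.app _ z, by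
    rw [← hz]
    exact (NatTrans.naturality_apply (c.ι.app j).hom m z).symm⟩

variable (N) in
theorem isClosedUnderDirectedColimits_modM : IsClosedUnderDirectedColimits κ N.modM where
  ι_mem _ _ _ _ hF _ hc := modM_ι_app hF hc
  desc_mem _ _ _ _ hF _ hc s hs := modM_of_comp_ι hF hc _ fun j ↦ by
    rw [hc.fac]
    exact hs j

end Nest

/-! ### Colimit closures and orthogonality. -/

section Factorization

variable {C : Type u} [Category.{v} C]

/-- Orthogonality as a bijectivity condition in the category of arrows. -/
theorem orthogonal_iff_bijective {A B X Y : C} (e : A ⟶ B) (m : X ⟶ Y) :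
    Orthogonal e m ↔ Function.Bijective (fun g : Arrow.mk e ⟶ Arrow.mk (𝟙 X) ↦
      g ≫ (Arrow.homMk (𝟙 X) m (by simp) : Arrow.mk (𝟙 X) ⟶ Arrow.mk m)) := by
  have hl (g : Arrow.mk e ⟶ Arrow.mk (𝟙 X)) : g.left = e ≫ g.right := by
    simpa using g.w
  constructor
  · intro h
    refine ⟨fun g g' hg ↦ ?_, fun s ↦ ?_⟩
    · have h₁ : g.left = g'.left := by simpa using congr_arg (fun φ ↦ φ.left) hg
      have h₂ : g.right ≫ m = g'.right ≫ m := congr_arg (fun φ ↦ φ.right) hg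
      have h₃ : g.right = g'.right := (h g.left (g.right ≫ m) (by simp [hl])).unique
        ⟨(hl g).symm, rfl⟩ ⟨by rw [h₁, hl], h₂.symm⟩
      exact Arrow.hom_ext _ _ h₁ h₃
    · obtain ⟨d, ⟨hd, hd'⟩, -⟩ := h s.left s.right (by simp)
      exact ⟨Arrow.homMk s.left d (by simpa using hd.symm),
        Arrow.hom_ext _ _ (by simp) (by simpa using hd')⟩
  · intro h f g hfg
    obtain ⟨s, hs⟩ := h.2 (Arrow.homMk f g (by simpa using hfg))
    have h₁ : s.left = f := by simpa using congr_arg (fun φ ↦ φ.left) hs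
    have h₂ : s.right ≫ m = g := by simpa using congr_arg (fun φ ↦ φ.right) hs
    refine ⟨s.right, ⟨by rw [← hl, h₁], h₂⟩, fun d hd ↦ ?_⟩
    have : (Arrow.homMk f d (by simpa using hd.1.symm) :
        Arrow.mk e ⟶ Arrow.mk (𝟙 X)) = s :=
      h.1 (hs.symm ▸ Arrow.hom_ext _ _ (by simp) (by simpa using hd.2))
    simpa using congr_arg (fun φ ↦ φ.right) this

/-- In the category of arrows, `e ⊥ m` says that `e` is colocal for the morphism from `𝟙 X` to `m`,
and colocal objects are closed under colimits. -/
theorem colimClosure_le (W : MorphismProperty C) :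
    colimClosure.{w} W ≤ leftOrthogonal (rightOrthogonal W) := by
  intro A B e he
  let T : MorphismProperty (Arrow C) :=
    .ofHoms (fun m : { m : Arrow C // rightOrthogonal W m.hom } ↦
      (Arrow.homMk (𝟙 m.1.left) m.1.hom (by simp) : Arrow.mk (𝟙 m.1.left) ⟶ Arrow.mk m.1.hom))
  have hT : ObjectProperty.colimitsClosure (C := Arrow C) (fun g ↦ W g.hom)
      (fun J : Cat.{w, w} ↦ (J : Type w)) ≤ T.isColocal := by
    refine ObjectProperty.colimitsClosure_le fun g hg ↦ ?_
    rintro _ _ _ ⟨m⟩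
    exact (orthogonal_iff_bijective g.hom m.1.hom).1 (m.2 g.hom hg)
  intro X Y m hm
  exact (orthogonal_iff_bijective e m).2 (hT _ he _
    (MorphismProperty.ofHoms.mk (⟨Arrow.mk m, hm⟩ : { m : Arrow C // rightOrthogonal W m.hom })))

theorem colimClosure_of_isColimit {W : MorphismProperty C} {J : Type w} [SmallCategory J]
    {D₁ D₂ : J ⥤ C} (α : D₁ ⟶ D₂) (hα : ∀ j, W (α.app j)) {c₁ : Cocone D₁} {c₂ : Cocone D₂}
    (hc₁ : IsColimit c₁) (hc₂ : IsColimit c₂) (f : c₁.pt ⟶ c₂.pt)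
    (hf : ∀ j, c₁.ι.app j ≫ f = α.app j ≫ c₂.ι.app j) : colimClosure.{w} W f := by
  let D : J ⥤ Arrow C :=
    { obj j := Arrow.mk (α.app j)
      map g := Arrow.homMk (D₁.map g) (D₂.map g) (by simp)
      map_id j := Arrow.hom_ext _ _ (by simp) (by simp)
      map_comp g h := Arrow.hom_ext _ _ (by simp) (by simp) }
  let ι : D ⟶ (Functor.const J).obj (Arrow.mk f) :=
    { app j := Arrow.homMk (c₁.ι.app j) (c₂.ι.app j) (hf j)
      naturality i j g := Arrow.hom_ext _ _ (c₁.ι.naturality g) (c₂.ι.naturality g) }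
  let s₁ (s : Cocone D) : Cocone D₁ :=
    { pt := s.pt.left
      ι := { app j := (s.ι.app j).left
             naturality i j g := congr_arg (fun φ ↦ φ.left) (s.ι.naturality g) } }
  let s₂ (s : Cocone D) : Cocone D₂ :=
    { pt := s.pt.right
      ι := { app j := (s.ι.app j).right
             naturality i j g := congr_arg (fun φ ↦ φ.right) (s.ι.naturality g) } }
  refine .of_colimitPresentation (a := Cat.of J)
    { diag := D
      ι := ι
      isColimit :=
        { desc s := Arrow.homMk (hc₁.desc (s₁ s)) (hc₂.desc (s₂ s)) (hc₁.hom_ext fun j ↦ by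
            refine (hc₁.fac_assoc (s₁ s) j _).trans ?_
            refine Eq.trans ?_ (Category.assoc (c₁.ι.app j) f _)
            rw [hf j, Category.assoc, hc₂.fac]
            exact (s.ι.app j).w)
          fac s j := Arrow.hom_ext _ _ (hc₁.fac (s₁ s) j) (hc₂.fac (s₂ s) j)
          uniq s g hg := Arrow.hom_ext _ _
            (hc₁.uniq (s₁ s) _ fun j ↦ congr_arg (fun φ ↦ φ.left) (hg j))
            (hc₂.uniq (s₂ s) _ fun j ↦ congr_arg (fun φ ↦ φ.right) (hg j)) } }
    fun j ↦ .of_mem _ (hα j)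

theorem isIso_of_leftOrthogonal {M : MorphismProperty C} {X Y Z : C} {e : X ⟶ Y} {e' : X ⟶ Z}
    {m : Z ⟶ Y} (he : leftOrthogonal M e) (he' : leftOrthogonal M e') (hm : M m)
    (h : e' ≫ m = e) : IsIso m := by
  obtain ⟨d, ⟨hd, hd'⟩, -⟩ := he m hm e' (𝟙 Y) (by simpa using h)
  refine ⟨d, ?_, hd'⟩
  exact (he' m hm e' m rfl).unique ⟨by rw [← Category.assoc, h, hd], by simp [hd']⟩ (by simp)

/-- If `e` is left orthogonal and factors as `e' ≫ m`, then `m` is an isomorphism. Thus `e` is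
isomorphic to `e'` as an arrow, and colimit closures are closed under isomorphism. -/
theorem isFactorizationSystem_colimClosure {W : MorphismProperty C}
    (h : ∀ ⦃X Y : C⦄ (f : X ⟶ Y), ∃ (Z : C) (e : X ⟶ Z) (m : Z ⟶ Y),
      colimClosure.{w} W e ∧ rightOrthogonal W m ∧ e ≫ m = f) :
    IsFactorizationSystem (colimClosure.{w} W) (rightOrthogonal W) where
  right_eq := le_antisymm (fun _ _ _ hm _ _ e he ↦ hm e (.of_mem _ he))
    (fun _ _ m hm _ _ e he ↦ colimClosure_le W e he m hm)
  left_eq := by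
    refine le_antisymm (fun X Y e he ↦ ?_) (colimClosure_le W)
    obtain ⟨Z, e', m, he', hm, rfl⟩ := h e
    have := isIso_of_leftOrthogonal he (colimClosure_le W e' he') hm rfl
    exact .of_isoClosure
      (Arrow.isoMk (f := Arrow.mk e') (g := Arrow.mk (e' ≫ m)) (Iso.refl _) (asIso m)) he'
  exists_factorization := h

end Factorization

/-! ### Models as colimits of representables, and the image factorization. -/

namespace Nest

variable {κ : Cardinal.{w}} {A : Type w} [SmallCategory.{w} A] (N : Nest κ A)

/-- The morphism from a representable model that corresponds to an element. -/
def ofElt {X : N.Mod} {a : A} (x : X.obj.obj a) : N.y.obj (op a) ⟶ X :=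
  ObjectProperty.homMk (coyonedaEquiv.symm x)

theorem ofElt_comp {X Y : N.Mod} {a : A} (x : X.obj.obj a) (f : X ⟶ Y) :
    N.ofElt x ≫ f = N.ofElt (f.hom.app a x) := by
  ext b (u : a ⟶ b)
  exact NatTrans.naturality_apply f.hom u x

theorem y_map_ofElt {X : N.Mod} {b a : A} (m : b ⟶ a) (x : X.obj.obj b) :
    N.y.map m.op ≫ N.ofElt x = N.ofElt (X.obj.map m x) := by
  ext c (u : a ⟶ c)
  exact ConcreteCategory.congr_hom (X.obj.map_comp m u) x

theorem ofElt_injective {X : N.Mod} {a : A} : Function.Injective (N.ofElt (X := X) (a := a)) :=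
  fun _ _ h ↦ coyonedaEquiv.symm.injective (congr_arg (fun φ ↦ φ.hom) h)

theorem ofElt_surjective {X : N.Mod} {a : A} : Function.Surjective (N.ofElt (X := X) (a := a)) :=
  fun g ↦ ⟨coyonedaEquiv g.hom, ObjectProperty.hom_ext _ (coyonedaEquiv.symm_apply_apply g.hom)⟩

/-- Every model is canonically a colimit of representable models. -/
abbrev elementsCocone (X : N.Mod) : Cocone ((CategoryOfElements.π X.obj).op ⋙ N.y) where
  pt := X
  ι :=
    { app p := N.ofElt p.unop.2
      naturality p q g := by
        refine (N.y_map_ofElt (X := X) g.unop.1 _).trans ?_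
        exact (congr_arg N.ofElt g.unop.2).trans (Category.comp_id _).symm }

theorem ι_app_hom_app {X : N.Mod} (s : Cocone ((CategoryOfElements.π X.obj).op ⋙ N.y)) {a b : A}
    (x : X.obj.obj a) (u : a ⟶ b) :
    (s.ι.app (op ⟨a, x⟩)).hom.app b u =
      (s.ι.app (op ⟨b, X.obj.map u x⟩)).hom.app b (𝟙 b) := by
  let g : X.obj.elementsMk a x ⟶ X.obj.elementsMk b (X.obj.map u x) := ⟨u, rfl⟩
  have := ConcreteCategory.congr_hom
    (congr_arg (fun φ ↦ NatTrans.app (InducedCategory.Hom.hom φ) b) (s.w g.op)) (𝟙 b)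
  refine Eq.trans ?_ this
  exact congr_arg ((s.ι.app (op ⟨a, x⟩)).hom.app b) (Category.comp_id u).symm

/-- The canonical cocone on a model is a colimit. -/
def isColimitElementsCocone (X : N.Mod) : IsColimit (N.elementsCocone X) where
  desc s := ObjectProperty.homMk
    { app a := ↾fun x ↦ (s.ι.app (op ⟨a, x⟩)).hom.app a (𝟙 a)
      naturality a b u := by
        ext x
        refine (N.ι_app_hom_app s x u).symm.trans ?_
        refine Eq.trans ?_ (NatTrans.naturality_apply (s.ι.app (op ⟨a, x⟩)).hom u (𝟙 a))
        exact congr_arg ((s.ι.app (op ⟨a, x⟩)).hom.app b) (Category.id_comp u).symm }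
  fac s p := by
    obtain ⟨a, x⟩ := p
    ext b (u : a ⟶ b)
    exact (N.ι_app_hom_app s x u).symm
  uniq s m hm := by
    ext a x
    have := ConcreteCategory.congr_hom
      (congr_arg (fun φ ↦ NatTrans.app (InducedCategory.Hom.hom φ) a) (hm (op ⟨a, x⟩))) (𝟙 a)
    refine Eq.trans ?_ this
    have hx : X.obj.map (𝟙 a) x = x := ConcreteCategory.congr_hom (X.obj.map_id a) x
    exact congr_arg (m.hom.app a) hx.symm

variable [Fact κ.IsRegular]

theorem epi_y_map {b a : A} (m : b ⟶ a) (hm : N.M m) : Epi (N.y.map m.op) where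
  left_cancellation {X} g h hgh := by
    obtain ⟨x, rfl⟩ := N.ofElt_surjective g
    obtain ⟨z, rfl⟩ := N.ofElt_surjective h
    have hxz := (N.y_map_ofElt m x).symm.trans (hgh.trans (N.y_map_ofElt m z))
    rw [X.property.map_injective hm (N.ofElt_injective hxz)]

theorem modM_ofElt {Y : N.Mod} {b : A} {z : Y.obj.obj b} (hz : N.IsMinimal Y.obj z) :
    N.modM (N.ofElt z) := by
  rw [modM_iff]
  exact fun d c m hm u hu ↦ hz m hm u hu

/-- `X` preserves the `κ`-small limits of `A`, so they lift to the category of elements and give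
cocones in its opposite. -/
instance isCardinalFiltered_elements (X : N.Mod) : IsCardinalFiltered X.obj.Elementsᵒᵖ κ where
  nonempty_cocone {K} _ D hK := by
    have hK' : HasCardinalLT (Arrow Kᵒᵖ) κ := by simpa
    have := N.hasLimitsOfShape Kᵒᵖ hK'
    have := X.property.preservesLimitsOfShape Kᵒᵖ hK'
    exact ⟨coconeOfConeLeftOp (limit.cone D.leftOp)⟩

section Image

variable {N} {X Y : N.Mod} (f : X ⟶ Y)

/-- The functor that sends an element of `X` to the core of its image under `f`. -/
noncomputable def imageCore : X.obj.Elements ⥤ A :=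
  CategoryOfElements.map f.hom ⋙ coreFunctor Y.property

/-- The inclusion of the core, as a natural transformation. -/
noncomputable def imageCoreι : imageCore f ⟶ CategoryOfElements.π X.obj :=
  (CategoryOfElements.map f.hom).whiskerLeft (coreFunctorι Y.property)

theorem imageCoreι_mem (p : X.obj.Elements) : N.M ((imageCoreι f).app p) :=
  coreι_mem Y.property _

/-- The diagram of representable models whose colimit is the image of `f`. -/
noncomputable def imageDiagram : X.obj.Elementsᵒᵖ ⥤ N.Mod := (imageCore f).op ⋙ N.y

/-- The core element at `p` is the image of the one at `q`, so a factorization through `m` over the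
core of `q` puts its image under `x` in the range of `m`; minimality at `p` then applies. -/
theorem modM_imageDiagram_map {p q : X.obj.Elementsᵒᵖ} (g : p ⟶ q) :
    N.modM ((imageDiagram f).map g) := by
  rw [modM_iff]
  intro b a m hm x ⟨t, ht⟩
  refine isMinimal_coreElt Y.property ((CategoryOfElements.map f.hom).obj p.unop) m hm x
    ⟨Y.obj.map t (coreElt Y.property ((CategoryOfElements.map f.hom).obj q.unop)), ?_⟩
  rw [← map_coreMap_coreElt Y.property ((CategoryOfElements.map f.hom).map g.unop)]
  refine (ConcreteCategory.congr_hom (Y.obj.map_comp t m) _).symm.trans ?_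
  refine Eq.trans ?_ (ConcreteCategory.congr_hom (Y.obj.map_comp _ x) _)
  exact congr_arg (fun v ↦ Y.obj.map v _) ht

/-- The image of `f`, as the point of a colimit cocone of models. -/
noncomputable def imageCocone : Cocone (imageDiagram f) :=
  coconeOfIsModel (colimit.cocone (imageDiagram f ⋙ N.isModel.ι))
    (isModel_of_isColimit (fun _ _ g ↦ modM_imageDiagram_map f g) (colimit.isColimit _))

/-- The image is a colimit. -/
noncomputable def isColimitImageCocone : IsColimit (imageCocone f) :=
  isColimitCoconeOfIsModel _ (colimit.isColimit _)

/-- The natural transformation between the diagrams that present `X` and the image of `f`. -/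
noncomputable def toImageDiagram :
    (CategoryOfElements.π X.obj).op ⋙ N.y ⟶ imageDiagram f :=
  Functor.whiskerRight (NatTrans.op (imageCoreι f)) N.y

/-- The first factor of the factorization of `f`. -/
noncomputable def toImage : X ⟶ (imageCocone f).pt :=
  (N.isColimitElementsCocone X).desc ((Cocone.precompose (toImageDiagram f)).obj (imageCocone f))

theorem ofElt_toImage (p : X.obj.Elementsᵒᵖ) :
    N.ofElt p.unop.2 ≫ toImage f =
      (toImageDiagram f).app p ≫ (imageCocone f).ι.app p :=
  (N.isColimitElementsCocone X).fac _ p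

theorem ofElt_toImage_comp (p : X.obj.Elementsᵒᵖ) {Z : N.Mod} (g : (imageCocone f).pt ⟶ Z) :
    N.ofElt p.unop.2 ≫ toImage f ≫ g =
      (toImageDiagram f).app p ≫ (imageCocone f).ι.app p ≫ g :=
  (Category.assoc _ _ _).symm.trans
    ((congr_arg (· ≫ g) (ofElt_toImage f p)).trans (Category.assoc _ _ _))

theorem modE_toImage : N.modE (toImage f) :=
  colimClosure_of_isColimit (toImageDiagram f)
    (fun p ↦ MorphismProperty.map_mem_strictMap _ N.y _ (imageCoreι_mem f p.unop))
    (N.isColimitElementsCocone X) (isColimitImageCocone f) _ (ofElt_toImage f)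

instance epi_toImageDiagram_app (p : X.obj.Elementsᵒᵖ) : Epi ((toImageDiagram f).app p) :=
  N.epi_y_map _ (imageCoreι_mem f p.unop)

theorem epi_toImage : Epi (toImage f) where
  left_cancellation g h hgh := (isColimitImageCocone f).hom_ext fun p ↦ by
    rw [← cancel_epi ((toImageDiagram f).app p), ← ofElt_toImage_comp, ← ofElt_toImage_comp, hgh]

/-- A morphism factors through the image of `f` as soon as it sends elements of `X` into all
`M`-subobjects into which `f` sends them. -/
theorem exists_toImage_comp_eq {Z : N.Mod} (g : X ⟶ Z)
    (h : ∀ ⦃b a : A⦄ (m : b ⟶ a), N.M m → ∀ x : X.obj.obj a,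
      f.hom.app a x ∈ Set.range (Y.obj.map m) → g.hom.app a x ∈ Set.range (Z.obj.map m)) :
    ∃ k, toImage f ≫ k = g := by
  have H (p : X.obj.Elementsᵒᵖ) : ∃ t : (imageDiagram f).obj p ⟶ Z,
      (toImageDiagram f).app p ≫ t = N.ofElt p.unop.2 ≫ g := by
    obtain ⟨z, hz⟩ := h _ (imageCoreι_mem f p.unop) p.unop.2
      ⟨_, map_coreι_coreElt Y.property ((CategoryOfElements.map f.hom).obj p.unop)⟩
    refine ⟨N.ofElt z, (N.y_map_ofElt _ z).trans ?_⟩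
    rw [hz]
    exact (N.ofElt_comp p.unop.2 g).symm
  choose t ht using H
  refine ⟨(isColimitImageCocone f).desc
    { pt := Z
      ι :=
        { app := t
          naturality p q a := ?_ } }, (N.isColimitElementsCocone X).hom_ext fun p ↦ ?_⟩
  -- The local lifts `t` are automatically compatible, because the morphisms from the representables
  -- of `X` to those of the image are epi.
  · rw [← cancel_epi ((toImageDiagram f).app p), ← NatTrans.naturality_assoc, ht]
    refine (Category.assoc _ _ _).symm.trans ?_
    refine (congr_arg (· ≫ g) ((N.elementsCocone X).w a)).trans ?_
    exact (ht p).symm.trans (congr_arg _ (Category.comp_id _).symm)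
  · refine (ofElt_toImage_comp f p _).trans ?_
    rw [IsColimit.fac]
    exact ht p

/-- The cocone that defines the second factor of the factorization of `f`. -/
noncomputable abbrev coreCocone : Cocone (imageDiagram f) where
  pt := Y
  ι :=
    { app p := N.ofElt (coreElt Y.property ((CategoryOfElements.map f.hom).obj p.unop))
      naturality p q g := by
        refine (N.y_map_ofElt _ _).trans (Eq.trans ?_ (Category.comp_id _).symm)
        exact congr_arg N.ofElt
          (map_coreMap_coreElt Y.property ((CategoryOfElements.map f.hom).map g.unop)) }

/-- The second factor of the factorization of `f`. -/
noncomputable def fromImage : (imageCocone f).pt ⟶ Y := (isColimitImageCocone f).desc (coreCocone f)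

theorem modM_fromImage : N.modM (fromImage f) :=
  modM_of_comp_ι (fun _ _ g ↦ modM_imageDiagram_map f g) (isColimitImageCocone f) _ fun p ↦ by
    rw [fromImage, IsColimit.fac]
    exact N.modM_ofElt (isMinimal_coreElt Y.property _)

theorem toImage_fromImage : toImage f ≫ fromImage f = f :=
  (N.isColimitElementsCocone X).hom_ext fun p ↦ by
    refine (ofElt_toImage_comp f p _).trans ?_
    rw [fromImage, IsColimit.fac]
    refine (N.y_map_ofElt _ _).trans (Eq.trans ?_ (N.ofElt_comp p.unop.2 f).symm)
    exact congr_arg N.ofElt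
      (map_coreι_coreElt Y.property ((CategoryOfElements.map f.hom).obj p.unop))

end Image

theorem isFactorizationSystem_mod : IsFactorizationSystem N.modE N.modM :=
  isFactorizationSystem_colimClosure fun _ _ f ↦
    ⟨_, toImage f, fromImage f, modE_toImage f, modM_fromImage f, toImage_fromImage f⟩

end Nest

/-! ### Limit preservation as locality, and cocompleteness of models. -/

section Comparison

variable {A : Type w} [SmallCategory.{w} A] {K : Type w} [SmallCategory K] {D : K ⥤ A}

/-- The canonical morphism from the colimit of the representable functors at the objects of a
diagram to the representable functor at the point of a cone. -/
noncomputable def comparison (c : Cone D) :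
    colimit (D.op ⋙ coyoneda) ⟶ coyoneda.obj (op c.pt) :=
  colimit.desc (D.op ⋙ coyoneda) (coyoneda.mapCocone c.op)

theorem comparison_comp_eq_iff (c : Cone D) {G : A ⥤ Type w} (g : coyoneda.obj (op c.pt) ⟶ G)
    (φ : colimit (D.op ⋙ coyoneda) ⟶ G) :
    comparison c ≫ g = φ ↔ ∀ k, G.map (c.π.app k) (coyonedaEquiv g) =
      coyonedaEquiv (colimit.ι (D.op ⋙ coyoneda) (op k) ≫ φ) := by
  have key (k : K) : G.map (c.π.app k) (coyonedaEquiv g) =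
      coyonedaEquiv (colimit.ι (D.op ⋙ coyoneda) (op k) ≫ comparison c ≫ g) := by
    rw [comparison, colimit.ι_desc_assoc]
    exact coyonedaEquiv_naturality g (c.π.app k)
  constructor
  · rintro rfl k
    exact key k
  · refine fun h ↦ colimit.hom_ext fun k ↦ coyonedaEquiv.injective ?_
    exact (key k.unop).symm.trans (h k.unop)

/-- A functor preserves a limit cone if and only if it is local with respect to the comparison
morphism. -/
theorem bijective_comparison_comp_iff (c : Cone D) (G : A ⥤ Type w) :
    Function.Bijective (fun g : coyoneda.obj (op c.pt) ⟶ G ↦ comparison c ≫ g) ↔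
      Nonempty (IsLimit (G.mapCone c)) := by
  rw [Types.isLimit_iff, Function.bijective_iff_existsUnique]
  constructor
  · intro h s hs
    let t : Cocone (D.op ⋙ coyoneda) :=
      { pt := G
        ι :=
          { app k := coyonedaEquiv.symm (s k.unop)
            naturality k l a := by
              have : G.map (D.map a.unop) (s l.unop) = s k.unop := hs a.unop
              rw [← this]
              refine (coyonedaEquiv_symm_map (F := G) (D.map a.unop) (s l.unop)).symm.trans ?_
              exact (Category.comp_id _).symm } }
    have ht (k : K) : coyonedaEquiv (colimit.ι (D.op ⋙ coyoneda) (op k) ≫ colimit.desc _ t) =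
        s k := by
      rw [colimit.ι_desc]
      exact coyonedaEquiv.apply_symm_apply _
    obtain ⟨g, hg, hg'⟩ := h (colimit.desc _ t)
    simp only [comparison_comp_eq_iff, ht] at hg hg'
    refine ⟨coyonedaEquiv g, hg, fun x hx ↦ ?_⟩
    rw [← hg' (coyonedaEquiv.symm x) fun k ↦ by
      rw [Equiv.apply_symm_apply]
      exact hx k, Equiv.apply_symm_apply]
  · intro h φ
    let s (k : K) : G.obj (D.obj k) :=
      coyonedaEquiv (X := D.obj k) (colimit.ι (D.op ⋙ coyoneda) (op k) ≫ φ)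
    obtain ⟨x, hx, hx'⟩ := h s (fun {k l} a ↦ by
      refine (coyonedaEquiv_naturality (X := D.obj k) (F := G) _ (D.map a)).trans ?_
      exact congr_arg (fun ψ ↦ coyonedaEquiv (X := D.obj l) (ψ ≫ φ))
        (colimit.w (D.op ⋙ coyoneda) a.op))
    refine ⟨coyonedaEquiv.symm x, (comparison_comp_eq_iff c _ φ).2 fun k ↦ ?_, fun g hg ↦ ?_⟩
    · rw [Equiv.apply_symm_apply]
      exact hx k
    · rw [← hx' (coyonedaEquiv g) ((comparison_comp_eq_iff c g φ).1 hg), Equiv.symm_apply_apply]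

instance isCardinalPresentable_coyoneda (κ : Cardinal.{w}) [Fact κ.IsRegular] (X : Aᵒᵖ) :
    IsCardinalPresentable (coyoneda.obj X) κ where
  preservesColimitOfShape J _ _ := by
    let e : coyoneda.obj (op (coyoneda.obj X)) ≅ (evaluation A (Type w)).obj X.unop :=
      NatIso.ofComponents (fun _ ↦ coyonedaEquiv.toIso) (fun _ ↦ rfl)
    exact preservesColimitsOfShape_of_natIso e.symm

/-- The functors that turn the members of a small family of cones into limit cones form a
reflective subcategory. -/
theorem isRightAdjoint_ι_of_cones {T : Type w} {K : T → Cat.{w, w}} {D : ∀ t, K t ⥤ A}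
    (c : ∀ t, Cone (D t)) {P : ObjectProperty (A ⥤ Type w)}
    (hP : ∀ G, P G ↔ ∀ t, Nonempty (IsLimit (G.mapCone (c t)))) : P.ι.IsRightAdjoint := by
  let W : MorphismProperty (A ⥤ Type w) := .ofHoms (fun t ↦ comparison (c t))
  obtain rfl : P = W.isLocal := by
    ext G
    simp only [hP, ← bijective_comparison_comp_iff]
    constructor
    · rintro h _ _ _ ⟨t⟩
      exact h t
    · exact fun h t ↦ h _ (.mk t)
  -- This `κ` bounds all shapes at once and is unrelated to that of a nest, whose multiple pullbacks
  -- can be larger.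
  obtain ⟨κ, hκ, h⟩ := HasCardinalLT.exists_regular_cardinal_forall.{w} (fun t ↦ Arrow (K t))
  have : Fact κ.IsRegular := ⟨hκ⟩
  refine W.isRightAdjoint_ι_isLocal κ ?_
  rintro _ _ _ ⟨t⟩
  have (k : (K t)ᵒᵖ) : IsCardinalPresentable (((D t).op ⋙ coyoneda).obj k) κ :=
    isCardinalPresentable_coyoneda κ _
  exact ⟨isCardinalPresentable_of_isColimit _ (colimit.isColimit ((D t).op ⋙ coyoneda)) κ
    (by simpa using h t), inferInstance⟩

end Comparison

namespace Nest

variable {κ : Cardinal.{w}} {A : Type w} [SmallCategory.{w} A] (N : Nest κ A)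

/-- The small sets of `M`-morphisms with a common codomain. -/
abbrev SubobjectFamily : Type w := Σ B : A, { S : Set (Over B) // ∀ f ∈ S, N.M f.hom }

/-- A small family of diagrams whose limits suffice to recognize models. -/
abbrev DiagramIndex : Type w :=
  (Σ S : SmallCategoryCardinalLT κ, SmallCategoryCardinalLT.categoryFamily κ S ⥤ A) ⊕
    N.SubobjectFamily

/-- The shapes of the diagrams. -/
def diagramShape : N.DiagramIndex → Cat.{w, w}
  | .inl x => Cat.of (SmallCategoryCardinalLT.categoryFamily κ x.1)
  | .inr x => Cat.of (WidePullbackShape x.2.1)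

/-- The diagrams. -/
def diagram : ∀ t : N.DiagramIndex, N.diagramShape t ⥤ A
  | .inl x => x.2
  | .inr x => WidePullbackShape.wideCospan x.1 (fun f : x.2.1 ↦ f.1.left) (fun f ↦ f.1.hom)

theorem hasLimit_diagram (t : N.DiagramIndex) : HasLimit (N.diagram t) := by
  obtain x | x := t
  · have := N.hasLimitsOfShape _ x.1.hasCardinalLT
    exact inferInstanceAs (HasLimit x.2)
  · exact N.hasWidePullback _ _ _ _ fun f ↦ x.2.2 f.1 f.2

variable [Fact κ.IsRegular]

/-- This replaces the proper class of diagrams in the definition of a model by a small family, as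
reflectivity requires. -/
theorem isModel_iff (G : A ⥤ Type w) :
    N.isModel G ↔ ∀ t, PreservesLimit (N.diagram t) G := by
  constructor
  · rintro h (x | x)
    · have := h.preservesLimitsOfShape _ x.1.hasCardinalLT
      exact inferInstanceAs (PreservesLimit x.2 G)
    · exact h.preservesWidePullback _ _ _ _ fun f ↦ x.2.2 f.1 f.2
  · intro h
    have h₁ (J : Type w) [SmallCategory J] (hJ : HasCardinalLT (Arrow J) κ) :
        PreservesLimitsOfShape J G := by
      obtain ⟨S, ⟨e⟩⟩ := SmallCategoryCardinalLT.exists_equivalence κ J hJ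
      have : PreservesLimitsOfShape (SmallCategoryCardinalLT.categoryFamily κ S) G :=
        ⟨fun {D} ↦ h (.inl ⟨S, D⟩)⟩
      exact preservesLimitsOfShape_of_equiv e G
    refine ⟨h₁, fun I B X f hf ↦ ?_⟩
    have := N.hasFiniteLimits
    have := preservesFiniteLimits_of_preservesFiniteLimitsOfSize.{w} G fun K _ _ ↦
      h₁ K (hasCardinalLT_arrow_of_finCategory κ K)
    have (i : I) : Mono (f i) := N.mono_of_mem _ (hf i)
    have := N.hasWidePullback I B X f hf
    have := mono_widePullback_base f
    refine preservesLimit_wideCospan f G (fun i ↦ (mono_iff_injective _).1 inferInstance)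
      ((mono_iff_injective _).1 inferInstance) fun x hx ↦ ?_
    -- Repetitions do not change an intersection of subobjects, so the family can be replaced by its
    -- set of members.
    let S : Set (Over B) := Set.range fun i ↦ Over.mk (f i)
    have hS : ∀ g ∈ S, N.M g.hom := by
      rintro _ ⟨i, rfl⟩
      exact hf i
    let s (g : S) : g.1.left ⟶ B := g.1.hom
    have : HasWidePullback B (fun g : S ↦ g.1.left) s := N.hasLimit_diagram (.inr ⟨B, S, hS⟩)
    have : PreservesLimit (WidePullbackShape.wideCospan B (fun g : S ↦ g.1.left) s) G :=
      h (.inr ⟨B, S, hS⟩)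
    obtain ⟨z, hz⟩ := mem_range_map_base s G x (by
      rintro ⟨_, i, rfl⟩
      exact hx i)
    let l : widePullback B (fun g : S ↦ g.1.left) s ⟶ widePullback B X f :=
      WidePullback.lift (WidePullback.base s) (fun i ↦ WidePullback.π s ⟨Over.mk (f i), i, rfl⟩)
        (fun i ↦ WidePullback.π_arrow s ⟨Over.mk (f i), i, rfl⟩)
    have hl : l ≫ WidePullback.base f = WidePullback.base s := WidePullback.lift_base _ _ _ _
    exact ⟨G.map l z, by rw [← comp_apply, ← Functor.map_comp, hl, hz]⟩

theorem hasColimits_mod : HasColimitsOfSize.{w, w} N.Mod := by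
  have := N.hasLimit_diagram
  have : N.isModel.ι.IsRightAdjoint := by
    refine isRightAdjoint_ι_of_cones (fun t ↦ limit.cone (N.diagram t)) fun G ↦ ?_
    rw [isModel_iff]
    exact forall_congr' fun t ↦ ⟨fun _ ↦ ⟨isLimitOfPreserves G (limit.isLimit _)⟩,
      fun h ↦ preservesLimit_of_preserves_limit_cone (limit.isLimit _) h.some⟩
  have : Reflective N.isModel.ι := { L := _, adj := Adjunction.ofIsRightAdjoint _ }
  exact hasColimits_of_reflective N.isModel.ι

end Nest

/-! ### Cowellpoweredness, generators and generated objects. -/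

namespace Nest

variable {κ : Cardinal.{w}} {A : Type w} [SmallCategory.{w} A] (N : Nest κ A) [Fact κ.IsRegular]

section Cowellpowered

variable {N} {X Z : N.Mod} {e : X ⟶ Z}

theorem isIso_fromImage (he : N.modE e) : IsIso (fromImage e) :=
  isIso_of_leftOrthogonal (colimClosure_le _ e he) (colimClosure_le _ _ (modE_toImage e))
    (modM_fromImage e) (toImage_fromImage e)

theorem epi_of_modE (he : N.modE e) : Epi e := by
  have := isIso_fromImage he
  have := epi_toImage e
  rw [← toImage_fromImage e]
  exact epi_comp _ _

variable (e) in
/-- The pairs of an element of `X` and an `M`-subobject that contains its image under `e`. -/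
def subobjectData : Set (Σ (a : A) (_ : X.obj.obj a) (b : A), b ⟶ a) :=
  { t | N.M t.2.2.2 ∧ e.hom.app t.1 t.2.1 ∈ Set.range (Z.obj.map t.2.2.2) }

/-- A morphism in `modE` agrees with its own `toImage` up to isomorphism, so it inherits the
extension property of images. -/
theorem exists_comp_eq (he : N.modE e) {Z' : N.Mod} {e' : X ⟶ Z'}
    (h : subobjectData e ⊆ subobjectData e') : ∃ g, e ≫ g = e' := by
  have := isIso_fromImage he
  obtain ⟨k, hk⟩ := exists_toImage_comp_eq e e' fun b a m hm x hx ↦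
    (h (show (⟨a, x, b, m⟩ : Σ (a : A) (_ : X.obj.obj a) (b : A), b ⟶ a) ∈ subobjectData e from
      ⟨hm, hx⟩)).2
  refine ⟨inv (fromImage e) ≫ k, ?_⟩
  rw [← hk]
  nth_rw 1 [← toImage_fromImage e]
  simp

theorem exists_iso_of_subobjectData_eq (he : N.modE e) {Z' : N.Mod} {e' : X ⟶ Z'}
    (he' : N.modE e') (h : subobjectData e = subobjectData e') :
    ∃ φ : Z ≅ Z', e ≫ φ.hom = e' := by
  obtain ⟨g, hg⟩ := exists_comp_eq he h.subset
  obtain ⟨g', hg'⟩ := exists_comp_eq he' h.superset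
  have := epi_of_modE he
  have := epi_of_modE he'
  exact ⟨⟨g, g', by simp [← cancel_epi e, reassoc_of% hg, hg'],
    by simp [← cancel_epi e', reassoc_of% hg', hg]⟩, hg⟩

end Cowellpowered

theorem isCowellpowered_modE : IsCowellpowered.{w} N.modE := by
  intro X
  let I := { S : Set (Σ (a : A) (_ : X.obj.obj a) (b : A), b ⟶ a) //
    ∃ (Z : N.Mod) (e : X ⟶ Z), N.modE e ∧ subobjectData e = S }
  choose Z e he hS using fun i : I ↦ i.2
  exact ⟨I, Z, e, he, fun Z' e' he' ↦ ⟨⟨_, Z', e', he', rfl⟩,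
    exists_iso_of_subobjectData_eq (he _) he' (hS _)⟩⟩

/-- The transition morphisms of the canonical diagram of `X` need not be in `modM`; those of the
image diagram of `𝟙 X` are. Its colimit is `X`, since `toImage (𝟙 X)` is both epi and split mono. -/
theorem exists_colimitPresentation (X : N.Mod) :
    ∃ (J : Type w) (_ : PartialOrder J) (_ : IsCardinalFiltered J κ)
      (pres : ColimitPresentation J X),
      (∀ j, ObjectProperty.ofObj N.y.obj (pres.diag.obj j)) ∧
        ∀ ⦃i j : J⦄ (a : i ⟶ j), N.modM (pres.diag.map a) := by
  have h := toImage_fromImage (𝟙 X)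
  have := epi_toImage (𝟙 X)
  have : IsIso ((isColimitImageCocone (𝟙 X)).desc (coreCocone (𝟙 X))) := ⟨toImage (𝟙 X), by
    rw [← cancel_epi (toImage (𝟙 X))]
    exact (Category.assoc _ _ _).symm.trans ((congr_arg (· ≫ toImage (𝟙 X)) h).trans (by simp)), h⟩
  let pres : ColimitPresentation X.obj.Elementsᵒᵖ X :=
    { diag := imageDiagram (𝟙 X)
      ι := (coreCocone (𝟙 X)).ι
      isColimit := (isColimitImageCocone (𝟙 X)).ofPointIso (t := coreCocone (𝟙 X)) }
  -- A final functor from a `κ`-directed poset replaces the filtered index category.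
  obtain ⟨J, _, _, F, _⟩ := IsCardinalFiltered.exists_cardinal_directed X.obj.Elementsᵒᵖ κ
  exact ⟨J, inferInstance, inferInstance, pres.reindex F,
    fun j ↦ ObjectProperty.ofObj_apply N.y.obj _, fun i j a ↦ modM_imageDiagram_map _ _⟩

/-- The Yoneda embedding is fully faithful. -/
def fullyFaithfulY : N.y.FullyFaithful where
  preimage f := Coyoneda.fullyFaithful.preimage f.hom
  map_preimage f := ObjectProperty.hom_ext _ (Coyoneda.fullyFaithful.map_preimage f.hom)
  preimage_map f := Coyoneda.fullyFaithful.preimage_map f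

/-- The identity of `X` factors through a stage of its presentation, so `X` is a retract of a
representable. The resulting idempotent comes from `A` and splits there because `A` has equalizers;
two splittings of one idempotent are isomorphic. -/
theorem isGenerated_le_essImage : IsGenerated κ N.modM ≤ N.y.essImage := by
  intro X hX
  obtain ⟨J, _, _, pres, hP, hM⟩ := N.exists_colimitPresentation X
  have := hX J pres.diag hM
  obtain ⟨j, s, hs⟩ := Types.jointly_surjective_of_isColimit
    (isColimitOfPreserves (coyoneda.obj (op X)) pres.isColimit) (𝟙 X)
  replace hs : s ≫ pres.ι.app j = 𝟙 X := hs
  obtain ⟨a, ha⟩ : ∃ a, N.y.obj a = pres.diag.obj j := by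
    obtain ⟨a, ha⟩ := (ObjectProperty.ofObj_iff _ _).1 (hP j)
    exact ⟨a, ha⟩
  obtain ⟨r, s, hs⟩ : ∃ (r : N.y.obj a ⟶ X) (s : X ⟶ N.y.obj a), s ≫ r = 𝟙 X :=
    ha ▸ ⟨pres.ι.app j, s, hs⟩
  have := N.hasFiniteLimits
  have : IsIdempotentComplete A :=
    Idempotents.isIdempotentComplete_iff_hasEqualizer_of_id_and_idempotent A |>.2
      fun _ _ _ ↦ inferInstance
  let p : a ⟶ a := N.fullyFaithfulY.preimage (r ≫ s)
  have hp : N.y.map p = r ≫ s := N.fullyFaithfulY.map_preimage _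
  obtain ⟨b, i, e, hie, hei⟩ := IsIdempotentComplete.idempotents_split a p
    (N.fullyFaithfulY.map_injective (by simp [hp, reassoc_of% hs]))
  have h₁ : N.y.map i ≫ N.y.map e = 𝟙 _ := by rw [← Functor.map_comp, hie, N.y.map_id]
  have h₂ : N.y.map e ≫ N.y.map i = r ≫ s := by rw [← Functor.map_comp, hei, hp]
  exact ⟨b, ⟨⟨N.y.map i ≫ r, s ≫ N.y.map e,
    by rw [Category.assoc, ← reassoc_of% h₂, h₁, Category.comp_id, h₁],
    by rw [Category.assoc, reassoc_of% h₂, hs, Category.comp_id, hs]⟩⟩⟩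

theorem essImage_y : N.y.essImage = IsGenerated κ N.modM := by
  refine le_antisymm ?_ N.isGenerated_le_essImage
  rintro X ⟨a, ⟨φ⟩⟩ J _ _ F hF
  have := N.isGenerated_y a J F hF
  exact preservesColimit_of_natIso F (coyoneda.mapIso φ.op.symm)

end Nest

end LocGen

theorem mainTheorem2 (κ : Cardinal.{w}) [Fact κ.IsRegular] (A : Type w) [SmallCategory.{w} A]
    (N : LocGen.Nest κ A) :
    LocGen.IsLocallyGenerated κ N.modE N.modM ∧
      (N.y.Full ∧ N.y.Faithful ∧ N.y.essImage = LocGen.IsGenerated κ N.modM) ∧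
      LocGen.IsCowellpowered.{w} N.modE := by
  refine ⟨⟨N.hasColimits_mod, ⟨N.isFactorizationSystem_mod, N.isCowellpowered_modE,
    N.isClosedUnderDirectedColimits_modM⟩, ObjectProperty.ofObj N.y.obj, inferInstance, ?_,
    N.exists_colimitPresentation⟩, ⟨N.fullyFaithfulY.full, N.fullyFaithfulY.faithful,
    N.essImage_y⟩, N.isCowellpowered_modE⟩
  rintro _ ⟨a⟩
  exact N.isGenerated_y a
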